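/- Let $k$ be a field and let $\mathcal A$ be a commutative cancellative semigroup with zero, generated by $\mathbf a_1,\dots,\mathbf a_r$ ($r\ge 1$). Assume that $\mathcal A$ is combinatorially finite (every nonzero element can be written in only finitely many ways as a sum of nonzero elements) and that its associated commutative group $G(\mathcal A)$ is torsion free. Let $R=k[X_1,\dots,X_r]$, graded by $\mathcal A$ with $\deg X_i=\mathbf a_i$, let $I_{\mathcal A}$ be the kernel of the $k$-algebra map $R\to k[\mathcal A]$, $X_i\mapsto \mathbf t^{\mathbf a_i}$, and let $\ker(\mathcal A)$ be the kernel of $\mathbb Z^r\to G(\mathcal A)$, $\mathbf e_i\mapsto\mathbf a_i$. Fix positive integers $d_1,\dots,d_r$ such that $\sum_i u_i\mathbf a_i=\sum_i v_i\mathbf a_i$ with $\mathbf u,\mathbf v\in\mathbb N^r$ implies $\sum_i d_iu_i=\sum_i d_iv_i$. For each $i$ let $\prec_i$ be a degree reverse lexicographic term order on $R$ with $X_i$ as lowest variable, that is, a term order represented by a real $r\times r$ matrix with first row $(d_1,\dots,d_r)$ and second row $-\mathbf e_i'$ (the latter being void if $r=1$). Let $\mathcal B$ be a system of generators of the group $\ker(\mathcal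 A)$, let $\mathcal G=\{X^{\mathbf u_+}-X^{\mathbf u_-}\mid \mathbf u\in\mathcal B\}$, where $\mathbf u_+,\mathbf u_-$ are the positive and negative parts of $\mathbf u$, and let $I_{\mathcal B}$ be the ideal generated by $\mathcal G$. Suppose that for every $i\in\{1,\dots,r\}$ the set $\mathcal G$ is, up to the signs of its elements, the reduced Gröbner basis of $I_{\mathcal B}$ with respect to $\prec_i$. Then: (a) $I_{\mathcal B}=I_{\mathcal A}$; (b) up to nonzero scalar multiples, the set of indispensable binomials of $I_{\mathcal A}$ is $\mathcal G$: a polynomial is an indispensable binomial of $I_{\mathcal A}$ if and only if it is a nonzero scalar multiple of an element of $\mathcal G$. In conclusion, $I_{\mathcal A}$ has a unique minimal system of binomial generators, up to nonzero scalar multiples of its elements. Here a binomial is a polynomial with exactly two terms, a system of generators is minimal if no proper subset of it generates the ideal, an element $\mathbf a\in\mathcal A$ is an indispensable $\mathcal A$-degree of $I_{\mathcal A}$ if every minimal system of $\mathcal A$-homogeneous generators of $I_{\mathcal A}$ contains one and only one polynomial of $\mathcal A$-degree $\mathbf a$, and an indispensable binomial of $I_{\mathcal A}$ is such a polynomial,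 for some indispensable $\mathcal A$-degree $\mathbf a$ and some minimal system of $\mathcal A$-homogeneous generators. -/

import Mathlib

open scoped MonomialOrder

namespace SemigroupIdeal

/-- A commutative monoid is combinatorially finite if every nonzero element can be written in only
finitely many ways (up to the order of the summands) as a sum of nonzero elements. -/
def IsCombinatoriallyFinite (A : Type*) [AddCommMonoid A] : Prop :=
  ∀ s : A, s ≠ 0 → {q : Multiset A | (0 : A) ∉ q ∧ q.sum = s}.Finite

/-- The ideal `I_A`: the kernel of the `k`-algebra morphism `k[X_1, …, X_r] → k[A]`,
`X_i ↦ t ^ (a_i)`, where `k[A]` is the semigroup algebra. -/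
noncomputable def semigroupIdeal (k : Type*) [Field k] {A : Type*} [AddCommMonoid A] {r : ℕ}
    (a : Fin r → A) : Ideal (MvPolynomial (Fin r) k) :=
  RingHom.ker
    (MvPolynomial.aeval (R := k) (fun i => (AddMonoidAlgebra.single (a i) 1 : AddMonoidAlgebra k A)))

/-- The morphism `ℤ ^ r → G(A)`, `e_i ↦ a_i`, to the associated commutative group of `A`. -/
noncomputable def latticeMap {A : Type*} [AddCommMonoid A] {r : ℕ} (a : Fin r → A) :
    (Fin r → ℤ) →+ Algebra.GrothendieckAddGroup A where
  toFun u := ∑ i, u i • Algebra.GrothendieckAddGroup.of (a i)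
  map_zero' := by simp
  map_add' u v := by simp [add_smul, Finset.sum_add_distrib]

/-- The exponent vector `u₊` of an integer vector `u`; note that `u₋ = (-u)₊`. -/
noncomputable def posExponent {r : ℕ} (u : Fin r → ℤ) : Fin r →₀ ℕ :=
  Finsupp.equivFunOnFinite.symm (fun i => (u i).toNat)

/-- The binomial `X ^ u₊ - X ^ u₋`. -/
noncomputable def latticeBinomial (k : Type*) [Field k] {r : ℕ} (u : Fin r → ℤ) :
    MvPolynomial (Fin r) k :=
  MvPolynomial.monomial (posExponent u) 1 - MvPolynomial.monomial (posExponent (-u)) 1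

/-- The set `G` of the binomials `X ^ u₊ - X ^ u₋` with `u ∈ B`. -/
noncomputable def binomialSet (k : Type*) [Field k] {r : ℕ} (B : Set (Fin r → ℤ)) :
    Set (MvPolynomial (Fin r) k) :=
  latticeBinomial k '' B

/-- The ideal `I_B` generated by the binomials `X ^ u₊ - X ^ u₋` with `u ∈ B`. -/
noncomputable def binomialIdeal (k : Type*) [Field k] {r : ℕ} (B : Set (Fin r → ℤ)) :
    Ideal (MvPolynomial (Fin r) k) :=
  Ideal.span (binomialSet k B)

/-- The term order `m` is represented by the matrix `M`: monomials are compared by comparing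
lexicographically (first row first) the images of their exponent vectors under `M`. -/
def IsRepresentedBy {r : ℕ} (m : MonomialOrder (Fin r)) (M : Matrix (Fin r) (Fin r) ℝ) : Prop :=
  ∀ u v : Fin r →₀ ℕ, u ≺[m] v ↔
    toLex (M.mulVec (fun j => (u j : ℝ))) < toLex (M.mulVec (fun j => (v j : ℝ)))

/-- `m` is a degree reverse lexicographic term order relative to the grading `deg X_j = d j` with
`X_i` as lowest variable: it is represented by an `r × r` matrix with first row `d` and second row
`-e_i` (for `r = 1` there is no second row). -/
def IsDegRevLexLowest {r : ℕ} (d : Fin r → ℕ) (i : Fin r) (m : MonomialOrder (Fin r)) : Prop :=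
  ∃ M : Matrix (Fin r) (Fin r) ℝ,
    (∀ p : Fin r, (p : ℕ) = 0 → M p = fun j => (d j : ℝ)) ∧
    (∀ p : Fin r, (p : ℕ) = 1 → M p = -Pi.single i (1 : ℝ)) ∧
    IsRepresentedBy m M

/-- `G` is a Gröbner basis of the ideal `I` with respect to `m`. -/
def IsGroebnerBasis {k : Type*} [Field k] {r : ℕ} (m : MonomialOrder (Fin r))
    (I : Ideal (MvPolynomial (Fin r) k)) (G : Set (MvPolynomial (Fin r) k)) : Prop :=
  G.Finite ∧ G ⊆ (I : Set (MvPolynomial (Fin r) k)) ∧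
    Ideal.span (m.leadingTerm '' G) =
      Ideal.span (m.leadingTerm '' (I : Set (MvPolynomial (Fin r) k)))

/-- `G` is the reduced Gröbner basis of `I` with respect to `m`: its elements are monic, and no
monomial occurring in an element of `G` is divisible by the initial monomial of another one. -/
def IsReducedGroebnerBasis {k : Type*} [Field k] {r : ℕ} (m : MonomialOrder (Fin r))
    (I : Ideal (MvPolynomial (Fin r) k)) (G : Set (MvPolynomial (Fin r) k)) : Prop :=
  IsGroebnerBasis m I G ∧ (∀ g ∈ G, m.Monic g) ∧
    ∀ g ∈ G, ∀ h ∈ G, h ≠ g → ∀ c ∈ g.support, ¬ m.degree h ≤ c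

/-- Equality of two sets of polynomials up to the signs of their elements. -/
def EqUpToSign {k : Type*} [Field k] {r : ℕ} (S T : Set (MvPolynomial (Fin r) k)) : Prop :=
  (∀ f ∈ S, f ∈ T ∨ -f ∈ T) ∧ (∀ f ∈ T, f ∈ S ∨ -f ∈ S)

/-- `G` is, up to the signs of its elements, the reduced Gröbner basis of `I` with respect to `m`.
The sign of `X ^ u₊ - X ^ u₋` that makes it monic depends on the term order, so this is the sense
in which one set of such binomials is a reduced Gröbner basis for several term orders. -/
def IsReducedGroebnerBasisUpToSign {k : Type*} [Field k] {r : ℕ} (m : MonomialOrder (Fin r))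
    (I : Ideal (MvPolynomial (Fin r) k)) (G : Set (MvPolynomial (Fin r) k)) : Prop :=
  ∃ G' : Set (MvPolynomial (Fin r) k), IsReducedGroebnerBasis m I G' ∧ EqUpToSign G G'

/-- `S` generates `I` and no proper subset of `S` does. -/
def IsMinimalGenerating {k : Type*} [Field k] {r : ℕ} (I : Ideal (MvPolynomial (Fin r) k))
    (S : Set (MvPolynomial (Fin r) k)) : Prop :=
  Ideal.span S = I ∧ ∀ T ⊆ S, Ideal.span T = I → T = S

/-- `S` is a minimal system of `A`-homogeneous generators of `I_A`, for the grading in which `X_i`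
has degree `a_i`. -/
def IsMinimalHomogeneousSystem {k : Type*} [Field k] {A : Type*} [AddCommMonoid A] {r : ℕ}
    (a : Fin r → A) (S : Set (MvPolynomial (Fin r) k)) : Prop :=
  IsMinimalGenerating (semigroupIdeal k a) S ∧
    ∀ f ∈ S, ∃ s : A, MvPolynomial.IsWeightedHomogeneous a f s

/-- `s` is an indispensable `A`-degree of `I_A`: every minimal system of `A`-homogeneous generators
contains one and only one polynomial of `A`-degree `s`. -/
def IsIndispensableDegree (k : Type*) [Field k] {A : Type*} [AddCommMonoid A] {r : ℕ}
    (a : Fin r → A) (s : A) : Prop :=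
  ∀ S : Set (MvPolynomial (Fin r) k), IsMinimalHomogeneousSystem a S →
    ∃! f, f ∈ S ∧ MvPolynomial.IsWeightedHomogeneous a f s

/-- `f` is an indispensable binomial of `I_A`: it is the polynomial of `A`-degree `s` in a minimal
system of `A`-homogeneous generators, for some indispensable `A`-degree `s`. -/
def IsIndispensableBinomial {k : Type*} [Field k] {A : Type*} [AddCommMonoid A] {r : ℕ}
    (a : Fin r → A) (f : MvPolynomial (Fin r) k) : Prop :=
  ∃ s : A, IsIndispensableDegree k a s ∧ MvPolynomial.IsWeightedHomogeneous a f s ∧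
    ∃ S : Set (MvPolynomial (Fin r) k), IsMinimalHomogeneousSystem a S ∧ f ∈ S

/-- A binomial: a polynomial with exactly two terms. -/
def IsBinomial {k : Type*} [Field k] {r : ℕ} (f : MvPolynomial (Fin r) k) : Prop :=
  f.support.card = 2

/-- `S` is a minimal system of binomial generators of `I`. -/
def IsMinimalBinomialSystem {k : Type*} [Field k] {r : ℕ} (I : Ideal (MvPolynomial (Fin r) k))
    (S : Set (MvPolynomial (Fin r) k)) : Prop :=
  IsMinimalGenerating I S ∧ ∀ f ∈ S, IsBinomial f

/-- Equality of two sets of polynomials up to nonzero scalar multiples of their elements. -/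
def EqUpToScalars {k : Type*} [Field k] {r : ℕ} (S T : Set (MvPolynomial (Fin r) k)) : Prop :=
  (∀ f ∈ S, ∃ c : k, c ≠ 0 ∧ c • f ∈ T) ∧ (∀ f ∈ T, ∃ c : k, c ≠ 0 ∧ c • f ∈ S)

end SemigroupIdeal

namespace SemigroupIdeal

open MvPolynomial

variable {k : Type*} [Field k] {A : Type*} [AddCancelCommMonoid A] {r : ℕ}

/-! The positive weight `d` is constant on each fibre, the set of exponent vectors of a given
`A`-degree, so on a fibre ≺_i compares first the exponents of X_i: the larger exponent is the
smaller monomial.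

Part (a). The vectors u₊ and u₋ have disjoint supports and equal weight, so the initial monomial of
X^u₊ - X^u₋ for ≺_i is prime to X_i. Hence X_i cancels from binomials modulo I_B
(`binomialRel_of_add_single`). Once every variable cancels, I_B contains X^α - X^β whenever α - β
lies in the group generated by `B` (`binomialRel_of_sub_mem_closure`), and these binomials generate
I_A (`semigroupIdeal_le`).

Part (b). The key is that the fibre of u₊ is {u₊, u₋} (`eq_posExponent_of_weight_eq`). By
reducedness the non-initial term of X^u₊ - X^u₋ is a standard monomial, so it is least in its fibre
and has the largest exponent of X_i there. Letting i vary bounds each w in the fibre by max(u₊, u₋);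
removing the common part of w and u₊ gives a relation between a divisor of X^u₋ and a divisor of
X^u₊, and reducedness then forces w to be u₊ or u₋.

A two-element fibre makes the corresponding component of I_A a line, which every homogeneous
generating set must meet outside 0. Indispensability and uniqueness follow, since a binomial in I_A
is automatically homogeneous. -/

theorem support_monomial_sub_monomial {α β : Fin r →₀ ℕ} (h : α ≠ β) :
    (monomial α (1 : k) - monomial β 1).support = {α, β} := by
  classical
  ext c
  simp only [mem_support_iff, coeff_sub, coeff_monomial, Finset.mem_insert, Finset.mem_singleton]
  by_cases h1 : α = c
  · subst h1; simp [h.symm]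
  · by_cases h2 : β = c
    · subst h2; simp [h]
    · simp [h1, h2, Ne.symm h1, Ne.symm h2]

theorem monomial_sub_monomial_ne_zero {α β : Fin r →₀ ℕ} (h : α ≠ β) :
    monomial α (1 : k) - monomial β 1 ≠ 0 := by
  rw [← support_nonempty, support_monomial_sub_monomial h]
  simp

theorem degree_monomial_sub_monomial (m : MonomialOrder (Fin r)) {α β : Fin r →₀ ℕ} (h : α ≠ β) :
    m.degree (monomial α (1 : k) - monomial β 1) = α ∨
      m.degree (monomial α (1 : k) - monomial β 1) = β := by
  have := m.degree_mem_support (monomial_sub_monomial_ne_zero (k := k) h)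
  rw [support_monomial_sub_monomial h] at this
  simpa using this

theorem aeval_single_monomial (a : Fin r → A) (α : Fin r →₀ ℕ) (c : k) :
    aeval (R := k) (fun i => (AddMonoidAlgebra.single (a i) 1 : AddMonoidAlgebra k A))
      (monomial α c) = AddMonoidAlgebra.single (Finsupp.weight a α) c := by
  have h : ∀ i, (AddMonoidAlgebra.single (a i) 1 : AddMonoidAlgebra k A)
      = AddMonoidAlgebra.of k A (Multiplicative.ofAdd (a i)) := fun i => rfl
  rw [aeval_monomial]
  simp only [h, ← map_pow]
  rw [Finsupp.prod, ← map_prod]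
  have h2 : (∏ i ∈ α.support, Multiplicative.ofAdd (a i) ^ α i)
      = Multiplicative.ofAdd (Finsupp.weight a α) := by
    rw [Finsupp.weight_apply, Finsupp.sum, ofAdd_sum]
    simp [ofAdd_nsmul]
  rw [h2, AddMonoidAlgebra.of_apply, toAdd_ofAdd]
  simp [AddMonoidAlgebra.single_mul_single]

theorem monomial_sub_monomial_mem_semigroupIdeal (a : Fin r → A) {α β : Fin r →₀ ℕ} :
    monomial α (1 : k) - monomial β 1 ∈ semigroupIdeal k a ↔
      Finsupp.weight a α = Finsupp.weight a β := by
  rw [semigroupIdeal, RingHom.mem_ker, map_sub, aeval_single_monomial, aeval_single_monomial,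
    sub_eq_zero]
  constructor
  · intro h
    exact AddMonoidAlgebra.single_left_injective one_ne_zero h
  · intro h; rw [h]

theorem monomial_notMem_semigroupIdeal (a : Fin r → A) (α : Fin r →₀ ℕ) {c : k} (hc : c ≠ 0) :
    monomial α c ∉ semigroupIdeal k a := by
  rw [semigroupIdeal, RingHom.mem_ker, aeval_single_monomial]
  intro h
  exact hc (by simpa using h)

/-- Two exponent vectors with the same `A`-degree, compared by a degree reverse lexicographic order
with `X_i` as lowest variable. -/
theorem IsDegRevLexLowest.apply_le {d : Fin r → ℕ} (hd : ∀ i, 0 < d i) {i : Fin r}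
    {m : MonomialOrder (Fin r)} (hm : IsDegRevLexLowest d i m) {α β : Fin r →₀ ℕ}
    (h : Finsupp.weight d α = Finsupp.weight d β) (hle : α ≼[m] β) : β i ≤ α i := by
  obtain ⟨M, h0, h1, hM⟩ := hm
  by_contra! hlt
  have hw : ∀ γ : Fin r →₀ ℕ, (Finsupp.weight d γ : ℕ) = ∑ j, γ j * d j := fun γ => by
    rw [Finsupp.weight_apply, Finsupp.sum_fintype _ _ (by simp)]; simp
  rw [hw, hw] at h
  rcases Nat.lt_or_ge r 2 with hr | hr
  -- With a single variable there is no second row, but the weight alone determines the exponent.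
  · have : Subsingleton (Fin r) := by
      rw [Fin.subsingleton_iff_le_one]; omega
    have hs : ∀ γ : Fin r →₀ ℕ, ∑ j, γ j * d j = γ i * d i := fun γ =>
      Fintype.sum_subsingleton _ i
    rw [hs, hs] at h
    exact hlt.ne (Nat.eq_of_mul_eq_mul_right (hd i) h)
  · refine absurd hle (not_le.2 ((hM β α).2 ?_))
    -- The comparison is decided in the second row: the first one ties because the weights agree.
    refine ⟨⟨1, hr⟩, ?_, ?_⟩
    · intro q hq
      have hq0 : (q : ℕ) = 0 := by
        have : (q : ℕ) < 1 := hq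
        omega
      change M.mulVec _ q = M.mulVec _ q
      simp only [Matrix.mulVec, h0 q hq0, dotProduct]
      have h' : (∑ j, (β j : ℝ) * d j) = ∑ j, (α j : ℝ) * d j := by exact_mod_cast h.symm
      simpa [mul_comm] using h'
    · change M.mulVec _ (⟨1, hr⟩ : Fin r) < M.mulVec _ (⟨1, hr⟩ : Fin r)
      simp only [Matrix.mulVec, h1 ⟨1, hr⟩ rfl]
      change (-Pi.single i (1 : ℝ)) ⬝ᵥ _ < (-Pi.single i (1 : ℝ)) ⬝ᵥ _
      rw [neg_dotProduct, neg_dotProduct, single_one_dotProduct, single_one_dotProduct]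
      simpa using hlt

theorem eq_of_le_of_weight_eq {d : Fin r → ℕ} (hd : ∀ i, 0 < d i) {α β : Fin r →₀ ℕ}
    (hle : α ≤ β) (h : Finsupp.weight d α = Finsupp.weight d β) : α = β := by
  obtain ⟨γ, rfl⟩ := le_iff_exists_add.1 hle
  have h0 : Finsupp.weight d γ = 0 := by simpa using h
  have : γ = 0 := by
    rw [Finsupp.weight_apply, Finsupp.sum_fintype _ _ (by simp)] at h0
    ext j
    have := (Finset.sum_eq_zero_iff.1 h0) j (Finset.mem_univ j)
    simpa [(hd j).ne'] using this
  simp [this]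

/-- Vectors with difference `u` are obtained from `u₊`, `u₋` by adding a common vector. -/
theorem exists_eq_posExponent_add {u : Fin r → ℤ} {α β : Fin r →₀ ℕ}
    (h : ∀ i, (α i : ℤ) - β i = u i) :
    ∃ c, α = posExponent u + c ∧ β = posExponent (-u) + c := by
  refine ⟨α - posExponent u, ?_, ?_⟩ <;> ext i <;> have := h i <;>
    simp [posExponent] <;> omega

theorem posExponent_apply (u : Fin r → ℤ) (i : Fin r) : posExponent u i = (u i).toNat := rfl

theorem weight_eq_iff_sub_mem_ker {a : Fin r → A} {α β : Fin r →₀ ℕ} :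
    (fun i => (α i : ℤ) - β i) ∈ (latticeMap a).ker ↔
      Finsupp.weight a α = Finsupp.weight a β := by
  have hinj : Function.Injective (Algebra.GrothendieckAddGroup.of (M := A)) :=
    Algebra.GrothendieckAddGroup.of_injective
  have hw : ∀ γ : Fin r →₀ ℕ, Algebra.GrothendieckAddGroup.of (Finsupp.weight a γ) =
      ∑ j, (γ j : ℤ) • Algebra.GrothendieckAddGroup.of (a j) := fun γ => by
    rw [Finsupp.weight_apply, Finsupp.sum_fintype _ _ (by simp)]; simp
  rw [← hinj.eq_iff, hw, hw, ← sub_eq_zero (b := ∑ j, (β j : ℤ) • _),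
    ← Finset.sum_sub_distrib, AddMonoidHom.mem_ker]
  simp [latticeMap, sub_smul]

theorem weight_posExponent_of_mem_ker {a : Fin r → A} {u : Fin r → ℤ}
    (hu : u ∈ (latticeMap a).ker) :
    Finsupp.weight a (posExponent u) = Finsupp.weight a (posExponent (-u)) := by
  rw [← weight_eq_iff_sub_mem_ker]
  convert hu using 1
  ext i
  simp only [posExponent_apply, Pi.neg_apply]
  omega

/-! ### Gröbner bases up to sign -/

theorem IsGroebnerBasis.exists_degree_le {m : MonomialOrder (Fin r)}
    {I : Ideal (MvPolynomial (Fin r) k)} {G : Set (MvPolynomial (Fin r) k)}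
    (h : IsGroebnerBasis m I G) {f : MvPolynomial (Fin r) k} (hf : f ∈ I) (hf0 : f ≠ 0) :
    ∃ g ∈ G, m.degree g ≤ m.degree f := by
  have h1 : m.leadingTerm f ∈ Ideal.span (m.leadingTerm '' G) := by
    rw [h.2.2]
    exact Ideal.subset_span ⟨f, hf, rfl⟩
  rw [m.span_leadingTerm_eq_span_monomial', ← Set.image_image (fun s => monomial s (1 : k)),
    mem_ideal_span_monomial_image] at h1
  obtain ⟨_, ⟨g, hg, rfl⟩, hle⟩ := h1 (m.degree f) (by rw [m.support_leadingTerm' hf0]; simp)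
  exact ⟨g, hg.1, hle⟩

namespace IsReducedGroebnerBasisUpToSign

variable {m : MonomialOrder (Fin r)} {I : Ideal (MvPolynomial (Fin r) k)}
  {G : Set (MvPolynomial (Fin r) k)}

theorem exists_degree_le (h : IsReducedGroebnerBasisUpToSign m I G)
    {f : MvPolynomial (Fin r) k} (hf : f ∈ I) (hf0 : f ≠ 0) :
    ∃ g ∈ G, m.degree g ≤ m.degree f := by
  obtain ⟨G', hG', hs⟩ := h
  obtain ⟨g, hg, hle⟩ := hG'.1.exists_degree_le hf hf0
  rcases hs.2 g hg with h1 | h1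
  · exact ⟨g, h1, hle⟩
  · exact ⟨-g, h1, by rwa [m.degree_neg]⟩

theorem ne_zero (h : IsReducedGroebnerBasisUpToSign m I G) {g : MvPolynomial (Fin r) k}
    (hg : g ∈ G) : g ≠ 0 := by
  obtain ⟨G', hG', hs⟩ := h
  rintro rfl
  have : m.Monic (0 : MvPolynomial (Fin r) k) := by
    rcases hs.1 0 hg with h1 | h1
    · exact hG'.2.1 _ h1
    · simpa using hG'.2.1 _ h1
  simp [MonomialOrder.Monic] at this

/-- Only the degrees can be identified: `G` may contain both `f` and `-f`, which correspond to a
single element of the reduced basis. -/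
theorem degree_eq_of_degree_le (h : IsReducedGroebnerBasisUpToSign m I G)
    {f g : MvPolynomial (Fin r) k} (hf : f ∈ G) (hg : g ∈ G) {c : Fin r →₀ ℕ}
    (hc : c ∈ g.support) (hle : m.degree f ≤ c) : m.degree f = m.degree g := by
  obtain ⟨G', hG', hs⟩ := h
  have key : ∀ p ∈ G, ∃ q ∈ G', m.degree q = m.degree p ∧ q.support = p.support := by
    intro p hp
    rcases hs.1 p hp with h1 | h1
    · exact ⟨p, h1, rfl, rfl⟩
    · exact ⟨-p, h1, m.degree_neg, support_neg _⟩
  obtain ⟨f', hf', hfd, -⟩ := key f hf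
  obtain ⟨g', hg', hgd, hgs⟩ := key g hg
  by_cases he : f' = g'
  · rw [← hfd, ← hgd, he]
  · exact absurd (hfd ▸ hle) (hG'.2.2 g' hg' f' hf' he c (hgs ▸ hc))

end IsReducedGroebnerBasisUpToSign

theorem posExponent_ne_of_latticeBinomial_ne_zero {u : Fin r → ℤ} (h : latticeBinomial k u ≠ 0) :
    posExponent u ≠ posExponent (-u) := by
  rintro h'
  exact h (by rw [latticeBinomial, h', sub_self])

/-- The initial exponent of `X ^ u₊ - X ^ u₋` is one of `u₊`, `u₋`, and the other one is smaller. -/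
theorem exists_trailing_exponent (m : MonomialOrder (Fin r)) {u : Fin r → ℤ}
    (h : latticeBinomial k u ≠ 0) :
    ∃ t, t ≠ m.degree (latticeBinomial k u) ∧ t ≼[m] m.degree (latticeBinomial k u) ∧
      (m.degree (latticeBinomial k u) = posExponent u ∧ t = posExponent (-u) ∨
        m.degree (latticeBinomial k u) = posExponent (-u) ∧ t = posExponent u) := by
  have hne := posExponent_ne_of_latticeBinomial_ne_zero h
  have hsup : (latticeBinomial k u).support = _ := support_monomial_sub_monomial hne
  rcases degree_monomial_sub_monomial (k := k) m hne with h1 | h1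
  · refine ⟨posExponent (-u), ?_, m.le_degree (by rw [hsup]; simp), Or.inl ⟨h1, rfl⟩⟩
    rw [latticeBinomial, h1]; exact hne.symm
  · refine ⟨posExponent u, ?_, m.le_degree (by rw [hsup]; simp), Or.inr ⟨h1, rfl⟩⟩
    rw [latticeBinomial, h1]; exact hne

/-- The congruence on exponent vectors defined by the binomials in an ideal. -/
def BinomialRel (I : Ideal (MvPolynomial (Fin r) k)) (α β : Fin r →₀ ℕ) : Prop :=
  monomial α (1 : k) - monomial β 1 ∈ I

namespace BinomialRel

variable {I : Ideal (MvPolynomial (Fin r) k)} {α β γ : Fin r →₀ ℕ}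

theorem refl (I : Ideal (MvPolynomial (Fin r) k)) (α : Fin r →₀ ℕ) : BinomialRel I α α := by
  simp [BinomialRel]

theorem symm (h : BinomialRel I α β) : BinomialRel I β α := by
  have := I.neg_mem h
  rwa [neg_sub] at this

theorem trans (h : BinomialRel I α β) (h' : BinomialRel I β γ) : BinomialRel I α γ := by
  have := I.add_mem h h'
  rwa [sub_add_sub_cancel] at this

theorem add_right (h : BinomialRel I α β) (γ : Fin r →₀ ℕ) : BinomialRel I (α + γ) (β + γ) := by
  have := I.mul_mem_right (monomial γ 1) h
  rwa [sub_mul, monomial_mul, monomial_mul, one_mul] at this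

theorem exists_min (m : MonomialOrder (Fin r)) (I : Ideal (MvPolynomial (Fin r) k))
    (α : Fin r →₀ ℕ) : ∃ β, BinomialRel I α β ∧ ∀ γ, BinomialRel I β γ → β ≼[m] γ := by
  obtain ⟨_, ⟨β, hβ, rfl⟩, hmin⟩ := (wellFounded_lt (α := m.syn)).has_min
    (m.toSyn '' {β | BinomialRel I α β}) ⟨_, α, refl I α, rfl⟩
  exact ⟨β, hβ, fun γ hγ => not_lt.1 (hmin _ ⟨γ, BinomialRel.trans hβ hγ, rfl⟩)⟩

end BinomialRel

theorem binomialRel_posExponent (k : Type*) [Field k] {B : Set (Fin r → ℤ)} {u : Fin r → ℤ}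
    (hu : u ∈ B) :
    BinomialRel (binomialIdeal k B) (posExponent u) (posExponent (-u)) :=
  Ideal.subset_span ⟨u, hu, rfl⟩

/-! ### Cancelling a variable modulo I_B -/

section Cancellation

variable {d : Fin r → ℕ} (hd : ∀ i, 0 < d i) {i : Fin r} {m : MonomialOrder (Fin r)}
  (hm : IsDegRevLexLowest d i m) {B : Set (Fin r → ℤ)}
  (hwd : ∀ u ∈ B, Finsupp.weight d (posExponent u) = Finsupp.weight d (posExponent (-u)))
  (hG : IsReducedGroebnerBasisUpToSign m (binomialIdeal k B) (binomialSet k B))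

include hd hm hwd hG

/-- The initial term has the smaller exponent at `i`, and one of the two exponents there is zero. -/
theorem degree_latticeBinomial_apply_eq_zero {u : Fin r → ℤ} (hu : u ∈ B) :
    m.degree (latticeBinomial k u) i = 0 := by
  obtain ⟨t, -, hle, h⟩ := exists_trailing_exponent m (hG.ne_zero ⟨u, hu, rfl⟩)
  have hw := hwd u hu
  rcases h with ⟨h1, h2⟩ | ⟨h1, h2⟩ <;> rw [h1, h2] at hle <;> rw [h1]
  · have := hm.apply_le hd hw.symm hle
    simp only [posExponent_apply, Pi.neg_apply] at this ⊢
    omega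
  · have := hm.apply_le hd hw hle
    simp only [posExponent_apply, Pi.neg_apply] at this ⊢
    omega

/-- An initial monomial prime to X_i that divides X_i X^α divides X^α already; replacing it by the
other term of its binomial would then give a smaller vector congruent to `α`. -/
theorem not_degree_le_add_single {u : Fin r → ℤ} (hu : u ∈ B) {α : Fin r →₀ ℕ}
    (hα : ∀ γ, BinomialRel (binomialIdeal k B) α γ → α ≼[m] γ) :
    ¬ m.degree (latticeBinomial k u) ≤ α + Finsupp.single i 1 := by
  intro hle
  have h0 := degree_latticeBinomial_apply_eq_zero hd hm hwd hG hu
  have hle' : m.degree (latticeBinomial k u) ≤ α := by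
    intro j
    have := hle j
    by_cases hj : j = i
    · subst hj; rw [h0]; exact Nat.zero_le _
    · simpa [Finsupp.single_apply, Ne.symm hj] using this
  obtain ⟨c, rfl⟩ := le_iff_exists_add.1 hle'
  obtain ⟨t, hne, hlt, h⟩ := exists_trailing_exponent m (hG.ne_zero ⟨u, hu, rfl⟩)
  have hrel : BinomialRel (binomialIdeal k B) (m.degree (latticeBinomial k u)) t := by
    rcases h with ⟨h1, h2⟩ | ⟨h1, h2⟩ <;> rw [h1, h2]
    · exact binomialRel_posExponent k hu
    · exact (binomialRel_posExponent k hu).symm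
  have hle2 := hα _ (hrel.add_right c)
  rw [map_add, map_add] at hle2
  exact hne (m.toSyn.injective (le_antisymm hlt (le_of_add_le_add_right hle2)))

theorem binomialRel_of_add_single {α β : Fin r →₀ ℕ}
    (h : BinomialRel (binomialIdeal k B) (α + Finsupp.single i 1) (β + Finsupp.single i 1)) :
    BinomialRel (binomialIdeal k B) α β := by
  -- Passing to least representatives makes both classes irreducible, and they remain so after
  -- multiplication by X_i; a nonzero difference would have a reducible initial term.
  obtain ⟨α', hα, hαm⟩ := BinomialRel.exists_min m (binomialIdeal k B) α
  obtain ⟨β', hβ, hβm⟩ := BinomialRel.exists_min m (binomialIdeal k B) β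
  have h' := ((hα.add_right _).symm.trans h).trans (hβ.add_right _)
  by_cases he : α' = β'
  · exact hα.trans (he ▸ hβ.symm)
  · have hne : α' + Finsupp.single i 1 ≠ β' + Finsupp.single i 1 := fun hh => he (by simpa using hh)
    obtain ⟨_, ⟨u, hu, rfl⟩, hle⟩ :=
      hG.exists_degree_le h' (monomial_sub_monomial_ne_zero (k := k) hne)
    rcases degree_monomial_sub_monomial (k := k) m hne with h1 | h1 <;> rw [h1] at hle
    · exact (not_degree_le_add_single hd hm hwd hG hu hαm hle).elim
    · exact (not_degree_le_add_single hd hm hwd hG hu hβm hle).elim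

end Cancellation

theorem binomialRel_of_add {I : Ideal (MvPolynomial (Fin r) k)}
    (hI : ∀ i α β, BinomialRel I (α + Finsupp.single i 1) (β + Finsupp.single i 1) →
      BinomialRel I α β) (γ : Fin r →₀ ℕ) :
    ∀ {α β : Fin r →₀ ℕ}, BinomialRel I (α + γ) (β + γ) → BinomialRel I α β := by
  induction γ using Finsupp.induction_linear with
  | zero => intro α β h; simpa using h
  | add f g hf hg =>
    intro α β h
    rw [← add_assoc, ← add_assoc] at h
    exact hf (hg h)
  | single i n =>
    induction n with
    | zero => intro α β h; simpa using h
    | succ n ih =>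
      intro α β h
      rw [Finsupp.single_add, ← add_assoc, ← add_assoc] at h
      exact ih (hI _ _ _ h)

/-- If the variables are cancellable modulo `I_B`, exponent vectors whose difference lies in the
group generated by `B` are congruent. -/
theorem binomialRel_of_sub_mem_closure {B : Set (Fin r → ℤ)}
    (hI : ∀ i α β, BinomialRel (binomialIdeal k B) (α + Finsupp.single i 1)
      (β + Finsupp.single i 1) → BinomialRel (binomialIdeal k B) α β)
    {u : Fin r → ℤ} (hu : u ∈ AddSubgroup.closure B) :
    ∀ α β : Fin r →₀ ℕ, (∀ i, (α i : ℤ) - β i = u i) →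
      BinomialRel (binomialIdeal k B) α β := by
  induction hu using AddSubgroup.closure_induction with
  | mem u hu =>
    intro α β h
    obtain ⟨c, rfl, rfl⟩ := exists_eq_posExponent_add h
    exact (binomialRel_posExponent k hu).add_right c
  | zero =>
    intro α β h
    have : α = β := by
      ext i; have := h i; simp at this; omega
    exact this ▸ BinomialRel.refl _ _
  | neg u _ ih =>
    intro α β h
    refine (ih β α fun i => ?_).symm
    have := h i
    simp at this
    omega
  | add u v _ _ ihu ihv =>
    intro α β h
    -- The intermediate vector α - u may have negative entries. Shifting by u₊ replaces it by α +
    -- u₋, and cancellation undoes the shift.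
    apply binomialRel_of_add hI (posExponent u)
    refine (ihu (α + posExponent u) (α + posExponent (-u)) fun i => ?_).trans
      (ihv (α + posExponent (-u)) (β + posExponent u) fun i => ?_)
    · simp [posExponent_apply]
    · have := h i
      simp [posExponent_apply] at this ⊢
      omega

theorem binomialIdeal_le_semigroupIdeal {a : Fin r → A} {B : Set (Fin r → ℤ)}
    (hB : B ⊆ (latticeMap a).ker) : binomialIdeal k B ≤ semigroupIdeal k a := by
  rw [binomialIdeal, Ideal.span_le]
  rintro _ ⟨u, hu, rfl⟩
  exact (monomial_sub_monomial_mem_semigroupIdeal a).2 (weight_posExponent_of_mem_ker (hB hu))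

/-- An ideal that contains all binomials of `I_A` contains `I_A`. -/
theorem semigroupIdeal_le {a : Fin r → A} {I : Ideal (MvPolynomial (Fin r) k)}
    (h : ∀ α β, Finsupp.weight a α = Finsupp.weight a β → BinomialRel I α β) :
    semigroupIdeal k a ≤ I := by
  classical
  -- `σ` picks one exponent vector in each degree; the additive map `ψ`, sending t^s to X^(σ s), is
  -- then a left inverse modulo `I` of X_i ↦ t^(a_i).
  let σ : A → (Fin r →₀ ℕ) := Function.invFun (Finsupp.weight a)
  have hσ : ∀ α, BinomialRel I (σ (Finsupp.weight a α)) α := fun α =>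
    h _ _ (Function.invFun_eq ⟨α, rfl⟩)
  let ψ : AddMonoidAlgebra k A →+ MvPolynomial (Fin r) k :=
    AddMonoidAlgebra.liftNC (algebraMap k (MvPolynomial (Fin r) k) : k →+ MvPolynomial (Fin r) k)
      (fun s => monomial (σ (Multiplicative.toAdd s)) (1 : k))
  have key : ∀ f : MvPolynomial (Fin r) k,
      ψ (aeval (R := k) (fun i => (AddMonoidAlgebra.single (a i) 1 : AddMonoidAlgebra k A)) f)
        - f ∈ I := by
    intro f
    induction f using MvPolynomial.induction_on' with
    | monomial α c =>
      rw [aeval_single_monomial]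
      have h1 : ψ (AddMonoidAlgebra.single (Finsupp.weight a α) c)
          = C c * monomial (σ (Finsupp.weight a α)) 1 := by
        simp only [ψ, AddMonoidAlgebra.liftNC_single]
        rfl
      rw [h1, ← mul_one c, ← C_mul_monomial, mul_one, ← mul_sub]
      exact I.mul_mem_left _ (hσ α)
    | add p q hp hq =>
      rw [map_add, map_add, add_sub_add_comm]
      exact I.add_mem hp hq
  intro f hf
  have := key f
  rw [semigroupIdeal, RingHom.mem_ker] at hf
  rw [hf, map_zero, zero_sub] at this
  exact neg_mem_iff.1 this

/-! ### The fibre of a generator has two elements -/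

section Fibre

variable {a : Fin r → A} {d : Fin r → ℕ} (hd : ∀ i, 0 < d i)
  (hwd : ∀ α β : Fin r →₀ ℕ, Finsupp.weight a α = Finsupp.weight a β →
    Finsupp.weight d α = Finsupp.weight d β)
  {m : Fin r → MonomialOrder (Fin r)} (hm : ∀ i, IsDegRevLexLowest d i (m i))
  {B : Set (Fin r → ℤ)} (hB : B ⊆ (latticeMap a).ker)
  (hG : ∀ i, IsReducedGroebnerBasisUpToSign (m i) (binomialIdeal k B) (binomialSet k B))
  (hI : binomialIdeal k B = semigroupIdeal k a)

include hd hwd hB hG hI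

include hm in
-- `t` is least in its fibre for ≺_i. Otherwise some X^w - X^t in the ideal would have initial term
-- X^t, divisible by the initial term of a generator; by reducedness that term is the initial term
-- of the binomial of `u` itself, which has the same weight as `t` and so would equal it.
theorem apply_le_trailing_exponent {u : Fin r → ℤ} (hu : u ∈ B) {i : Fin r} {t w : Fin r →₀ ℕ}
    (hne : t ≠ (m i).degree (latticeBinomial k u))
    (ht : (m i).degree (latticeBinomial k u) = posExponent u ∧ t = posExponent (-u) ∨
      (m i).degree (latticeBinomial k u) = posExponent (-u) ∧ t = posExponent u)
    (hw : Finsupp.weight a w = Finsupp.weight a (posExponent u)) : w i ≤ t i := by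
  have hpn := weight_posExponent_of_mem_ker (hB hu)
  have hsup : (latticeBinomial k u).support = _ := support_monomial_sub_monomial
    (posExponent_ne_of_latticeBinomial_ne_zero ((hG i).ne_zero ⟨u, hu, rfl⟩))
  have htw : Finsupp.weight a t = Finsupp.weight a w := by
    rcases ht with ⟨-, rfl⟩ | ⟨-, rfl⟩
    · rw [hw, hpn]
    · rw [hw]
  by_cases he : w = t
  · rw [he]
  have hmem : monomial w (1 : k) - monomial t 1 ∈ binomialIdeal k B := by
    rw [hI]; exact (monomial_sub_monomial_mem_semigroupIdeal a).2 htw.symm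
  obtain ⟨g, hg, hle⟩ := (hG i).exists_degree_le hmem (monomial_sub_monomial_ne_zero he)
  rcases degree_monomial_sub_monomial (k := k) (m i) he with h1 | h1
  · refine (hm i).apply_le hd (hwd _ _ htw) ?_
    rw [← h1]
    exact (m i).le_degree (by rw [support_monomial_sub_monomial he]; simp)
  · rw [h1] at hle
    have hts : t ∈ (latticeBinomial k u).support := by
      rw [hsup]; rcases ht with ⟨-, rfl⟩ | ⟨-, rfl⟩ <;> simp
    have hdeg := (hG i).degree_eq_of_degree_le hg ⟨u, hu, rfl⟩ hts hle
    rw [hdeg] at hle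
    refine absurd (eq_of_le_of_weight_eq hd hle (hwd _ _ ?_)).symm hne
    rcases ht with ⟨h2, h3⟩ | ⟨h2, h3⟩ <;> rw [h2, h3, hpn]

include hm in
/-- The only monomials of the `A`-degree of `X ^ u₊ - X ^ u₋` are its two terms. -/
theorem eq_posExponent_of_weight_eq {u : Fin r → ℤ} (hu : u ∈ B) {w : Fin r →₀ ℕ}
    (hw : Finsupp.weight a w = Finsupp.weight a (posExponent u)) :
    w = posExponent u ∨ w = posExponent (-u) := by
  have hpn := weight_posExponent_of_mem_ker (hB hu)
  have hdisj : ∀ j, posExponent u j = 0 ∨ posExponent (-u) j = 0 := fun j => by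
    simp only [posExponent_apply, Pi.neg_apply]; omega
  have hmax : ∀ i w, Finsupp.weight a w = Finsupp.weight a (posExponent u) →
      w i ≤ posExponent u i ∨ w i ≤ posExponent (-u) i := by
    intro i w hw
    obtain ⟨t, hne, -, ht⟩ := exists_trailing_exponent (m i) ((hG i).ne_zero ⟨u, hu, rfl⟩)
    have := apply_le_trailing_exponent hd hwd hm hB hG hI hu hne ht hw
    rcases ht with ⟨-, rfl⟩ | ⟨-, rfl⟩
    · exact Or.inr this
    · exact Or.inl this
  -- At each index one of u₊, u₋ vanishes and the other bounds `w`.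
  have hsum : w ⊓ posExponent (-u) + w ⊓ posExponent u = w := by
    ext j
    have h1 := hdisj j
    have h2 := hmax j w hw
    simp only [Finsupp.add_apply, Finsupp.inf_apply]
    omega
  have hsub : posExponent u - w ⊓ posExponent u + w ⊓ posExponent u = posExponent u :=
    tsub_add_cancel_of_le inf_le_right
  have hwt : Finsupp.weight a (w ⊓ posExponent (-u)) =
      Finsupp.weight a (posExponent u - w ⊓ posExponent u) := by
    apply add_right_cancel (b := Finsupp.weight a (w ⊓ posExponent u))
    rw [← map_add, ← map_add, hsum, hsub, hw]
  -- The two sides have disjoint supports, so equality makes both zero, whence u₊ ≤ w.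
  by_cases he : w ⊓ posExponent (-u) = posExponent u - w ⊓ posExponent u
  · left
    refine (eq_of_le_of_weight_eq hd (fun j => ?_) (hwd _ _ hw.symm)).symm
    have h1 := hdisj j
    have h2 := DFunLike.congr_fun he j
    simp only [Finsupp.tsub_apply, Finsupp.inf_apply] at h2
    omega
  right
  -- An index in the support of u₊ makes u₋ the initial exponent for ≺_i. If u₊ were zero,
  -- positivity of the weight would force u₋ = u₊.
  obtain ⟨i, hi⟩ : ∃ i, posExponent u i ≠ 0 := by
    by_contra! h0
    by_cases hr : Nonempty (Fin r)
    · obtain ⟨i⟩ := hr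
      refine posExponent_ne_of_latticeBinomial_ne_zero ((hG i).ne_zero ⟨u, hu, rfl⟩)
        (eq_of_le_of_weight_eq hd (fun j => ?_) (hwd _ _ hpn))
      rw [h0 j]; exact Nat.zero_le _
    · exact he (by ext i; exact (hr ⟨i⟩).elim)
  have hpne := posExponent_ne_of_latticeBinomial_ne_zero ((hG i).ne_zero ⟨u, hu, rfl⟩)
  have hsup : (latticeBinomial k u).support = _ := support_monomial_sub_monomial hpne
  have hlead : (m i).degree (latticeBinomial k u) = posExponent (-u) := by
    obtain ⟨t, hne, -, ht⟩ := exists_trailing_exponent (m i) ((hG i).ne_zero ⟨u, hu, rfl⟩)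
    have := apply_le_trailing_exponent hd hwd hm hB hG hI hu hne ht rfl
    rcases ht with ⟨-, rfl⟩ | ⟨h, -⟩
    · have := hdisj i
      omega
    · exact h
  have hmem : monomial (w ⊓ posExponent (-u)) (1 : k)
      - monomial (posExponent u - w ⊓ posExponent u) 1 ∈ binomialIdeal k B := by
    rw [hI]; exact (monomial_sub_monomial_mem_semigroupIdeal a).2 hwt
  obtain ⟨g, hg, hle⟩ := (hG i).exists_degree_le hmem (monomial_sub_monomial_ne_zero he)
  -- Either possible initial term divides u₊ or u₋, so by reducedness the initial exponent dividing
  -- it is u₋. In the first case u₋ ≤ w; in the second u₋ ≤ u₊, which is impossible.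
  rcases degree_monomial_sub_monomial (k := k) (m i) he with h1 | h1 <;> rw [h1] at hle
  · have hdeg := (hG i).degree_eq_of_degree_le (c := posExponent (-u)) hg ⟨u, hu, rfl⟩
      (by rw [hsup]; simp) (hle.trans inf_le_right)
    rw [hdeg, hlead] at hle
    exact (eq_of_le_of_weight_eq hd (hle.trans inf_le_left)
      (hwd _ _ (hpn.symm.trans hw.symm))).symm
  · have hdeg := (hG i).degree_eq_of_degree_le (c := posExponent u) hg ⟨u, hu, rfl⟩
      (by rw [hsup]; simp) (hle.trans tsub_le_self)
    rw [hdeg, hlead] at hle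
    exact absurd (eq_of_le_of_weight_eq hd (hle.trans tsub_le_self) (hwd _ _ hpn.symm)).symm hpne

end Fibre

theorem exists_mem_support_le_of_mem_span {S : Set (MvPolynomial (Fin r) k)}
    {f : MvPolynomial (Fin r) k} (hf : f ∈ Ideal.span S) {p : Fin r →₀ ℕ} (hp : p ∈ f.support) :
    ∃ h ∈ S, ∃ c ∈ h.support, c ≤ p := by
  have hle : Ideal.span S ≤ Ideal.span ((fun s => monomial s (1 : k)) ''
      {c | ∃ h ∈ S, c ∈ h.support}) := by
    rw [Ideal.span_le]
    intro h hh
    exact mem_ideal_span_monomial_image.2 fun c hc => ⟨c, ⟨h, hh, hc⟩, le_rfl⟩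
  obtain ⟨c, ⟨h, hh, hc⟩, hcp⟩ := mem_ideal_span_monomial_image.1 (hle hf) p hp
  exact ⟨h, hh, c, hc, hcp⟩

theorem exists_ne_mem_support {a : Fin r → A} {f : MvPolynomial (Fin r) k}
    (hf : f ∈ semigroupIdeal k a) {c : Fin r →₀ ℕ} (hc : c ∈ f.support) :
    ∃ c' ∈ f.support, c' ≠ c := by
  by_contra! h
  have hfm : f = monomial c (coeff c f) := by
    ext e
    rw [coeff_monomial]
    split_ifs with he
    · rw [he]
    · by_contra h0
      exact he (h e (mem_support_iff.2 h0)).symm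
  rw [hfm] at hf
  exact monomial_notMem_semigroupIdeal a c (mem_support_iff.1 hc) hf

/-! ### Homogeneous generators in a two-element fibre -/

section UniqueFibre

variable {a : Fin r → A} {u : Fin r → ℤ}
  (hwt : Finsupp.weight a (posExponent u) = Finsupp.weight a (posExponent (-u)))
  (hne : posExponent u ≠ posExponent (-u))
  (hfib : ∀ w : Fin r →₀ ℕ, Finsupp.weight a w = Finsupp.weight a (posExponent u) →
    w = posExponent u ∨ w = posExponent (-u))

include hwt in
theorem isWeightedHomogeneous_latticeBinomial :
    IsWeightedHomogeneous a (latticeBinomial k u) (Finsupp.weight a (posExponent u)) :=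
  Submodule.sub_mem (weightedHomogeneousSubmodule k a _)
    (isWeightedHomogeneous_monomial _ _ _ rfl) (isWeightedHomogeneous_monomial _ _ _ hwt.symm)

include hwt hne hfib in
-- Subtracting a multiple of the binomial leaves a single monomial term, and I_A contains no nonzero
-- one.
theorem exists_eq_smul_latticeBinomial {f : MvPolynomial (Fin r) k} (hf : f ∈ semigroupIdeal k a)
    (hh : IsWeightedHomogeneous a f (Finsupp.weight a (posExponent u))) :
    ∃ c : k, f = c • latticeBinomial k u := by
  have hf' : f = monomial (posExponent u) (coeff (posExponent u) f)
      + monomial (posExponent (-u)) (coeff (posExponent (-u)) f) := by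
    ext e
    rw [coeff_add, coeff_monomial, coeff_monomial]
    by_cases h1 : posExponent u = e
    · subst h1; simp [hne.symm]
    · by_cases h2 : posExponent (-u) = e
      · subst h2; simp [hne]
      · rw [if_neg h1, if_neg h2, add_zero]
        by_contra h0
        rcases hfib e (hh h0) with h | h
        · exact h1 h.symm
        · exact h2 h.symm
  set x := coeff (posExponent u) f
  set y := coeff (posExponent (-u)) f
  have hsplit : f = x • latticeBinomial k u + monomial (posExponent (-u)) (x + y) := by
    rw [hf', latticeBinomial, smul_sub, smul_monomial, smul_monomial, map_add]
    simp only [smul_eq_mul, mul_one]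
    abel
  refine ⟨x, ?_⟩
  by_cases hxy : x + y = 0
  · rw [hsplit, hxy, map_zero, add_zero]
  · refine absurd ?_ (monomial_notMem_semigroupIdeal a (posExponent (-u)) hxy)
    have hl : x • latticeBinomial k u ∈ semigroupIdeal k a :=
      Submodule.smul_of_tower_mem _ x ((monomial_sub_monomial_mem_semigroupIdeal a).2 hwt)
    rw [hsplit] at hf
    exact (Ideal.add_mem_iff_right _ hl).1 hf

include hwt hne hfib in
-- Some generator has a term X^c dividing X^u₊, and, as I_A contains no monomial, a second term
-- X^c'. With u₊ = c + e, the vector c' + e lies in the fibre and must be u₋; disjointness of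
-- supports gives e = 0.
theorem exists_mem_isWeightedHomogeneous {S : Set (MvPolynomial (Fin r) k)}
    (hS : Ideal.span S = semigroupIdeal k a)
    (hh : ∀ f ∈ S, ∃ s : A, IsWeightedHomogeneous a f s) :
    ∃ f ∈ S, f ≠ 0 ∧ IsWeightedHomogeneous a f (Finsupp.weight a (posExponent u)) := by
  have hmem : latticeBinomial k u ∈ Ideal.span S := by
    rw [hS]; exact (monomial_sub_monomial_mem_semigroupIdeal a).2 hwt
  have hsup : (latticeBinomial k u).support = _ := support_monomial_sub_monomial hne
  obtain ⟨f, hf, c, hc, hle⟩ := exists_mem_support_le_of_mem_span hmem (p := posExponent u)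
    (by rw [hsup]; simp)
  obtain ⟨c', hc', hcc⟩ := exists_ne_mem_support (a := a) (hS ▸ Ideal.subset_span hf) hc
  obtain ⟨s, hs⟩ := hh f hf
  obtain ⟨e, he⟩ := le_iff_exists_add.1 hle
  have hw : Finsupp.weight a (c' + e) = Finsupp.weight a (posExponent u) := by
    rw [he, map_add, map_add, hs (mem_support_iff.1 hc), hs (mem_support_iff.1 hc')]
  have hce : c' + e = posExponent (-u) := by
    refine (hfib _ hw).resolve_left fun h => hcc ?_
    rw [he] at h
    exact add_right_cancel h
  have he0 : e = 0 := by
    ext j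
    have h1 := DFunLike.congr_fun he j
    have h2 := DFunLike.congr_fun hce j
    simp only [Finsupp.add_apply, posExponent_apply, Pi.neg_apply] at h1 h2
    simp only [Finsupp.coe_zero, Pi.zero_apply]
    omega
  refine ⟨f, hf, fun h0 => by simp [h0] at hc, ?_⟩
  have : Finsupp.weight a (posExponent u) = s := by
    rw [he, he0, add_zero, hs (mem_support_iff.1 hc)]
  rwa [this]

theorem IsMinimalGenerating.zero_notMem {I : Ideal (MvPolynomial (Fin r) k)}
    {S : Set (MvPolynomial (Fin r) k)} (h : IsMinimalGenerating I S) : (0 : _) ∉ S := by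
  intro h0
  have := h.2 (S \ {0}) Set.sdiff_subset (by rw [Ideal.span_sdiff_singleton_zero, h.1])
  rw [← this] at h0
  exact h0.2 rfl

/-- In a minimal generating set no element is a scalar multiple of another one. -/
theorem IsMinimalGenerating.eq_of_eq_smul {I : Ideal (MvPolynomial (Fin r) k)}
    {S : Set (MvPolynomial (Fin r) k)} (h : IsMinimalGenerating I S)
    {f g : MvPolynomial (Fin r) k} (hf : f ∈ S) (hg : g ∈ S) {c : k} (hc : f = c • g) : f = g := by
  by_contra hne
  have hspan : Ideal.span (S \ {f}) = I := by
    rw [← h.1]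
    refine le_antisymm (Ideal.span_mono Set.sdiff_subset) (Ideal.span_le.2 fun x hx => ?_)
    by_cases hxf : x = f
    · have h1 : c • g ∈ Ideal.span (S \ {f}) :=
        Submodule.smul_of_tower_mem _ c (Ideal.subset_span ⟨hg, Ne.symm hne⟩)
      rw [← hc] at h1
      rwa [hxf]
    · exact Ideal.subset_span ⟨hx, hxf⟩
  have := h.2 _ Set.sdiff_subset hspan
  rw [← this] at hf
  exact hf.2 rfl

include hwt hne hfib in
theorem isIndispensableDegree_weight_posExponent :
    IsIndispensableDegree k a (Finsupp.weight a (posExponent u)) := by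
  intro S hS
  obtain ⟨f, hf, hf0, hfh⟩ := exists_mem_isWeightedHomogeneous hwt hne hfib hS.1.1 hS.2
  refine ⟨f, ⟨hf, hfh⟩, ?_⟩
  rintro g ⟨hg, hgh⟩
  have hmem : ∀ h ∈ S, h ∈ semigroupIdeal k a := fun h hh => hS.1.1 ▸ Ideal.subset_span hh
  obtain ⟨x, hx⟩ := exists_eq_smul_latticeBinomial hwt hne hfib (hmem f hf) hfh
  obtain ⟨y, hy⟩ := exists_eq_smul_latticeBinomial hwt hne hfib (hmem g hg) hgh
  have hx0 : x ≠ 0 := by rintro rfl; exact hf0 (by simpa using hx)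
  refine hS.1.eq_of_eq_smul hg hf (c := y * x⁻¹) ?_
  rw [hx, hy, smul_smul, inv_mul_cancel_right₀ hx0]

end UniqueFibre

theorem span_le_span_of_smul_mem {S T : Set (MvPolynomial (Fin r) k)}
    (h : ∀ f ∈ S, ∃ c : k, c ≠ 0 ∧ c • f ∈ T) : Ideal.span S ≤ Ideal.span T := by
  refine Ideal.span_le.2 fun f hf => ?_
  obtain ⟨c, hc, hcf⟩ := h f hf
  have := Submodule.smul_of_tower_mem (Ideal.span T) c⁻¹ (Ideal.subset_span hcf)
  rwa [inv_smul_smul₀ hc] at this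

theorem EqUpToSign.eqUpToScalars {S T : Set (MvPolynomial (Fin r) k)} (h : EqUpToSign S T) :
    EqUpToScalars S T := by
  refine ⟨fun f hf => ?_, fun f hf => ?_⟩
  · rcases h.1 f hf with h | h
    · exact ⟨1, one_ne_zero, by simpa using h⟩
    · exact ⟨-1, neg_ne_zero.2 one_ne_zero, by simpa using h⟩
  · rcases h.2 f hf with h | h
    · exact ⟨1, one_ne_zero, by simpa using h⟩
    · exact ⟨-1, neg_ne_zero.2 one_ne_zero, by simpa using h⟩

/-- Terms of distinct degrees would have distinct images in the semigroup algebra and could not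
cancel. -/
theorem IsBinomial.isWeightedHomogeneous {a : Fin r → A} {f : MvPolynomial (Fin r) k}
    (hb : IsBinomial f) (hf : f ∈ semigroupIdeal k a) : ∃ s, IsWeightedHomogeneous a f s := by
  classical
  obtain ⟨α, β, hne, hs⟩ := Finset.card_eq_two.1 hb
  have hα : coeff α f ≠ 0 := mem_support_iff.1 (by rw [hs]; simp)
  have hfe := f.as_sum
  rw [hs, Finset.sum_pair hne] at hfe
  have hw : Finsupp.weight a α = Finsupp.weight a β := by
    by_contra hw
    rw [hfe, semigroupIdeal, RingHom.mem_ker, map_add, aeval_single_monomial,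
      aeval_single_monomial] at hf
    have := congrArg (fun x => x.coeff (Finsupp.weight a α)) hf
    simp [Ne.symm hw] at this
    exact hα this
  refine ⟨Finsupp.weight a α, fun e he => ?_⟩
  have : e ∈ f.support := mem_support_iff.2 he
  rw [hs, Finset.mem_insert, Finset.mem_singleton] at this
  rcases this with rfl | rfl
  · rfl
  · exact hw.symm

/-! ### Minimal systems and indispensable binomials -/

section Main

variable {a : Fin r → A} {B : Set (Fin r → ℤ)} {m : MonomialOrder (Fin r)}
  (hne : ∀ u ∈ B, posExponent u ≠ posExponent (-u))
  (hwt : ∀ u ∈ B, Finsupp.weight a (posExponent u) = Finsupp.weight a (posExponent (-u)))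
  (hfib : ∀ u ∈ B, ∀ w : Fin r →₀ ℕ, Finsupp.weight a w = Finsupp.weight a (posExponent u) →
    w = posExponent u ∨ w = posExponent (-u))
  (hI : binomialIdeal k B = semigroupIdeal k a) {G : Set (MvPolynomial (Fin r) k)}
  (hG : IsReducedGroebnerBasis m (binomialIdeal k B) G) (hs : EqUpToSign (binomialSet k B) G)

include hs

theorem exists_eq_smul_of_mem {g : MvPolynomial (Fin r) k} (hg : g ∈ G) :
    ∃ u ∈ B, ∃ c : k, c ≠ 0 ∧ g = c • latticeBinomial k u := by
  obtain ⟨c, hc, u, hu, h⟩ := hs.eqUpToScalars.2 g hg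
  exact ⟨u, hu, c⁻¹, inv_ne_zero hc, by rw [h, inv_smul_smul₀ hc]⟩

include hne hwt hfib hI hG

/-- Every nonzero multiple of the reduced Gröbner basis is a minimal homogeneous system. -/
theorem isMinimalHomogeneousSystem_smul {c : k} (hc : c ≠ 0) :
    IsMinimalHomogeneousSystem a ((fun g => c • g) '' G) := by
  have hspan : Ideal.span ((fun g => c • g) '' G) = semigroupIdeal k a := by
    rw [← hI]
    refine le_antisymm (span_le_span_of_smul_mem ?_) (span_le_span_of_smul_mem ?_)
    · rintro _ ⟨g, hg, rfl⟩
      obtain ⟨x, hx, h⟩ := hs.eqUpToScalars.2 g hg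
      exact ⟨x * c⁻¹, mul_ne_zero hx (inv_ne_zero hc), by
        rwa [smul_smul, inv_mul_cancel_right₀ hc]⟩
    · intro f hf
      obtain ⟨x, hx, h⟩ := hs.eqUpToScalars.1 f hf
      exact ⟨c * x, mul_ne_zero hc hx, x • f, h, (smul_smul _ _ _)⟩
  have hhom : ∀ f ∈ (fun g => c • g) '' G, ∃ s : A, IsWeightedHomogeneous a f s := by
    rintro _ ⟨g, hg, rfl⟩
    obtain ⟨u, hu, x, -, rfl⟩ := exists_eq_smul_of_mem hs hg
    exact ⟨_, Submodule.smul_mem (weightedHomogeneousSubmodule k a _) c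
      (Submodule.smul_mem _ x (isWeightedHomogeneous_latticeBinomial (hwt u hu)))⟩
  refine ⟨⟨hspan, fun T hT hTs => Set.Subset.antisymm hT ?_⟩, hhom⟩
  rintro _ ⟨g, hg, rfl⟩
  obtain ⟨u, hu, x, hx, hgx⟩ := exists_eq_smul_of_mem hs hg
  -- A generating subset still needs a nonzero element in the degree of `g`. It is a multiple of
  -- some `g'` proportional to `g`, and reducedness gives `g' = g`.
  obtain ⟨f, hf, hf0, hfh⟩ := exists_mem_isWeightedHomogeneous (hwt u hu) (hne u hu) (hfib u hu)
    hTs fun f hf => hhom f (hT hf)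
  obtain ⟨y, hy⟩ := exists_eq_smul_latticeBinomial (hwt u hu) (hne u hu) (hfib u hu)
    (hTs ▸ Ideal.subset_span hf) hfh
  obtain ⟨g', hg', rfl⟩ := hT hf
  have hy0 : y ≠ 0 := by rintro rfl; exact hf0 (by simpa using hy)
  suffices g = g' by rwa [this]
  by_contra hgg
  have hg0 : g ≠ 0 := by
    rw [hgx]
    exact smul_ne_zero hx (monomial_sub_monomial_ne_zero (hne u hu))
  refine hG.2.2 g' hg' g hg hgg (m.degree g) ?_ le_rfl
  have hg'g : g' = (c⁻¹ * y * x⁻¹) • g := by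
    rw [hgx, smul_smul, inv_mul_cancel_right₀ hx, mul_smul, ← hy]
    exact (inv_smul_smul₀ hc g').symm
  rw [hg'g, mem_support_iff, coeff_smul, smul_eq_mul]
  exact mul_ne_zero (mul_ne_zero (mul_ne_zero (inv_ne_zero hc) hy0) (inv_ne_zero hx))
    (mem_support_iff.1 (m.degree_mem_support hg0))

theorem isMinimalHomogeneousSystem_of_reduced : IsMinimalHomogeneousSystem a G := by
  simpa using isMinimalHomogeneousSystem_smul hne hwt hfib hI hG hs one_ne_zero

theorem isIndispensableBinomial_iff (f : MvPolynomial (Fin r) k) :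
    IsIndispensableBinomial a f ↔
      ∃ g ∈ binomialSet k B, ∃ c : k, c ≠ 0 ∧ f = c • g := by
  constructor
  · rintro ⟨s, hind, hfs, S, hS, hfS⟩
    obtain ⟨g, ⟨hg, hgs⟩, -⟩ := hind G (isMinimalHomogeneousSystem_of_reduced hne hwt hfib hI hG hs)
    obtain ⟨u, hu, x, hx, rfl⟩ := exists_eq_smul_of_mem hs hg
    have hsup : (latticeBinomial k u).support = _ := support_monomial_sub_monomial (hne u hu)
    have hcoef : coeff (posExponent u) (latticeBinomial k u) ≠ 0 :=
      mem_support_iff.1 (by rw [hsup]; simp)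
    have hs' : Finsupp.weight a (posExponent u) = s :=
      hgs (by rw [coeff_smul, smul_eq_mul]; exact mul_ne_zero hx hcoef)
    obtain ⟨c, hc⟩ := exists_eq_smul_latticeBinomial (hwt u hu) (hne u hu) (hfib u hu)
      (hS.1.1 ▸ Ideal.subset_span hfS) (hs' ▸ hfs)
    refine ⟨_, ⟨u, hu, rfl⟩, c, ?_, hc⟩
    rintro rfl
    rw [zero_smul] at hc
    exact hS.1.zero_notMem (hc ▸ hfS)
  · rintro ⟨_, ⟨u, hu, rfl⟩, c, hc, rfl⟩
    obtain ⟨x, hx, h⟩ := hs.eqUpToScalars.1 _ ⟨u, hu, rfl⟩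
    -- `G` contains `x` times the binomial, so scaling all of `G` by `c * x⁻¹` gives a minimal
    -- system containing exactly `c` times it.
    refine ⟨_, isIndispensableDegree_weight_posExponent (hwt u hu) (hne u hu) (hfib u hu),
      Submodule.smul_mem (weightedHomogeneousSubmodule k a _) c
        (isWeightedHomogeneous_latticeBinomial (hwt u hu)), _,
      isMinimalHomogeneousSystem_smul hne hwt hfib hI hG hs
        (mul_ne_zero hc (inv_ne_zero hx)), _, h, ?_⟩
    change (c * x⁻¹) • x • latticeBinomial k u = _
    rw [smul_smul, inv_mul_cancel_right₀ hx]

theorem isMinimalBinomialSystem_of_reduced : IsMinimalBinomialSystem (semigroupIdeal k a) G := by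
  refine ⟨(isMinimalHomogeneousSystem_of_reduced hne hwt hfib hI hG hs).1, fun g hg => ?_⟩
  obtain ⟨u, hu, x, hx, rfl⟩ := exists_eq_smul_of_mem hs hg
  have hsup : (latticeBinomial k u).support = _ := support_monomial_sub_monomial (hne u hu)
  rw [IsBinomial, support_smul_eq hx, hsup, Finset.card_pair (hne u hu)]

theorem IsMinimalBinomialSystem.eqUpToScalars {T : Set (MvPolynomial (Fin r) k)}
    (hT : IsMinimalBinomialSystem (semigroupIdeal k a) T) : EqUpToScalars T G := by
  have hGT : ∀ g ∈ G, ∃ c : k, c ≠ 0 ∧ c • g ∈ T := by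
    intro g hg
    obtain ⟨u, hu, x, hx, rfl⟩ := exists_eq_smul_of_mem hs hg
    obtain ⟨f, hf, hf0, hfh⟩ := exists_mem_isWeightedHomogeneous (hwt u hu) (hne u hu) (hfib u hu)
      hT.1.1 fun f hf => (hT.2 f hf).isWeightedHomogeneous (hT.1.1 ▸ Ideal.subset_span hf)
    obtain ⟨y, rfl⟩ := exists_eq_smul_latticeBinomial (hwt u hu) (hne u hu) (hfib u hu)
      (hT.1.1 ▸ Ideal.subset_span hf) hfh
    have hy0 : y ≠ 0 := by rintro rfl; exact hf0 (zero_smul _ _)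
    exact ⟨y * x⁻¹, mul_ne_zero hy0 (inv_ne_zero hx), by
      rwa [smul_smul, inv_mul_cancel_right₀ hx]⟩
  refine ⟨?_, hGT⟩
  -- The elements of `T` proportional to elements of `G` already generate, so minimality leaves no
  -- room for others.
  have hT' : {f ∈ T | ∃ c : k, c ≠ 0 ∧ c • f ∈ G} = T := by
    refine hT.1.2 _ (Set.sep_subset _ _) (le_antisymm ?_ ?_)
    · rw [← hT.1.1]
      exact Ideal.span_mono (Set.sep_subset _ _)
    · rw [← (isMinimalHomogeneousSystem_of_reduced hne hwt hfib hI hG hs).1.1]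
      refine span_le_span_of_smul_mem fun g hg => ?_
      obtain ⟨c, hc, h⟩ := hGT g hg
      exact ⟨c, hc, h, c⁻¹, inv_ne_zero hc, by rwa [inv_smul_smul₀ hc]⟩
  intro f hf
  rw [← hT'] at hf
  exact hf.2

end Main

end SemigroupIdeal

open SemigroupIdeal

theorem corollary3p4 {k : Type*} [Field k] {A : Type*} [AddCancelCommMonoid A]
    (hfin : SemigroupIdeal.IsCombinatoriallyFinite A)
    (htf : IsAddTorsionFree (Algebra.GrothendieckAddGroup A))
    {r : ℕ} (hr : 1 ≤ r) (a : Fin r → A)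
    (ha : AddSubmonoid.closure (Set.range a) = ⊤)
    (d : Fin r → ℕ) (hd : ∀ i, 0 < d i)
    (hcomp : ∀ u v : Fin r → ℕ, ∑ i, u i • a i = ∑ i, v i • a i →
      ∑ i, d i * u i = ∑ i, d i * v i)
    (m : Fin r → MonomialOrder (Fin r))
    (hm : ∀ i, SemigroupIdeal.IsDegRevLexLowest d i (m i))
    (B : Set (Fin r → ℤ))
    (hB : AddSubgroup.closure B = (SemigroupIdeal.latticeMap a).ker)
    (hG : ∀ i, SemigroupIdeal.IsReducedGroebnerBasisUpToSign (m i)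
      (SemigroupIdeal.binomialIdeal k B) (SemigroupIdeal.binomialSet k B)) :
    SemigroupIdeal.binomialIdeal k B = SemigroupIdeal.semigroupIdeal k a ∧
    (∀ f : MvPolynomial (Fin r) k, SemigroupIdeal.IsIndispensableBinomial a f ↔
      ∃ g ∈ SemigroupIdeal.binomialSet k B, ∃ c : k, c ≠ 0 ∧ f = c • g) ∧
    (∃ S : Set (MvPolynomial (Fin r) k),
      SemigroupIdeal.IsMinimalBinomialSystem (SemigroupIdeal.semigroupIdeal k a) S ∧
      ∀ T : Set (MvPolynomial (Fin r) k),
        SemigroupIdeal.IsMinimalBinomialSystem (SemigroupIdeal.semigroupIdeal k a) T →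
          SemigroupIdeal.EqUpToScalars T S) := by
  have hwd : ∀ α β : Fin r →₀ ℕ, Finsupp.weight a α = Finsupp.weight a β →
      Finsupp.weight d α = Finsupp.weight d β := by
    intro α β h
    simp only [Finsupp.weight_apply] at h ⊢
    rw [Finsupp.sum_fintype _ _ (by simp), Finsupp.sum_fintype _ _ (by simp)] at h ⊢
    simpa [mul_comm] using hcomp α β h
  have hBk : B ⊆ (latticeMap a).ker := hB ▸ AddSubgroup.subset_closure
  have hwt : ∀ u ∈ B, Finsupp.weight a (posExponent u) = Finsupp.weight a (posExponent (-u)) :=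
    fun u hu => weight_posExponent_of_mem_ker (hBk hu)
  have hI : binomialIdeal k B = semigroupIdeal k a := by
    refine le_antisymm (binomialIdeal_le_semigroupIdeal hBk) (semigroupIdeal_le fun α β h => ?_)
    refine binomialRel_of_sub_mem_closure (u := fun i => (α i : ℤ) - β i)
      (fun i α β => binomialRel_of_add_single hd (hm i) (fun u hu => hwd _ _ (hwt u hu)) (hG i))
      ?_ α β fun i => rfl
    rw [hB]
    exact weight_eq_iff_sub_mem_ker.2 h
  have hne : ∀ u ∈ B, posExponent u ≠ posExponent (-u) := fun u hu =>
    posExponent_ne_of_latticeBinomial_ne_zero ((hG ⟨0, hr⟩).ne_zero ⟨u, hu, rfl⟩)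
  have hfib := fun u hu w => eq_posExponent_of_weight_eq hd hwd hm hBk hG hI (u := u) hu (w := w)
  obtain ⟨G, hGr, hs⟩ := hG ⟨0, hr⟩
  exact ⟨hI, isIndispensableBinomial_iff hne hwt hfib hI hGr hs, G,
    isMinimalBinomialSystem_of_reduced hne hwt hfib hI hGr hs,
    fun T hT => hT.eqUpToScalars hne hwt hfib hI hGr hs⟩
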